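/- Let $\omega:[0,\infty)\to[0,\infty)$ be a continuous increasing (i.e. non-decreasing) function such that - $(\alpha)$ there is $A\ge 1$ with $\omega(2t)\le A(1+\omega(t))$ for all $t\ge 0$; - $(\beta)$ $\int_1^\infty \omega(t)\,t^{-2}\,dt<\infty$; - $(\gamma)'$ there are $a\in\mathbb{R}$, $b>0$ with $\omega(t)\ge a+b\log(1+t)$ for all $t\ge 0$; - $(\delta)$ $\varphi(t):=\omega(e^t)$ is convex on $[0,\infty)$. Write $\omega(z):=\omega\big(\sum_{j=1}^N|z_j|\big)$ for $z\in\mathbb{C}^N$, and $\varphi^*(y):=\sup_{x\ge 0}(xy-\varphi(x))\in(-\infty,+\infty]$ for $y\ge 0$, with the convention $e^{-\infty}=0$. For $z\in\mathbb{C}^N$ let $\hat f(z):=\int_{\mathbb{R}^N}f(t)e^{-i\langle t,z\rangle}\,dt$, where $\langle t,z\rangle=\sum_j t_jz_j$. Let $K\subset\mathbb{R}^N$ be a non-empty convex compact set with supporting function $H_K(\eta):=\sup_{x\in K}\langle x,\eta\rangle$. Let $\mathcal{D}(K)$ be the set of $f\in C^\infty(\mathbb{R}^N)$ (complex valued) with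 $\operatorname{supp}f\subset K$, and let $$\mathcal{D}_{(\omega)}(K):=\Big\{f\in\mathcal{D}(K):\ \int_{\mathbb{R}^N}|\hat f(t)|\,e^{\lambda\omega(t)}\,dt<\infty\ \text{ for all }\lambda>0\Big\}.$$ **Theorem (Paley–Wiener theorem for $\omega$-ultradifferentiable functions of Beurling type).** Let $f\in L^1(\mathbb{R}^N)$. The following are equivalent (in (1) and (2), membership means that $f$ agrees almost everywhere with an element of the space, with which it is identified): 1. $f\in\mathcal{D}_{(\omega)}(K)$; 2. $f\in\mathcal{D}(K)$ and, for every integer $k\ge 1$, $$\sup_{\alpha\in\mathbb{N}_0^N}\ \sup_{x\in\mathbb{R}^N}|f^{(\alpha)}(x)|\,e^{-k\varphi^*(|\alpha|/k)}<\infty;$$ 3. the integral $\hat f(z)$ converges absolutely for every $z\in\mathbb{C}^N$ and, for every integer $k\ge 1$, there is $C_k>0$ such that $$|\hat f(z)|\le C_k\,e^{H_K(\operatorname{Im}z)-k\omega(z)}\qquad\text{for all }z\in\mathbb{C}^N.$$ -/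

import Mathlib

open MeasureTheory Set
open scoped ENNReal

noncomputable section

namespace PaleyWienerBeurling

/-- Non-quasianalytic weight functions `ω ∈ 𝒲'`. The function `ω : [0,∞) → [0,∞)` is represented
by a function on `ℝ` of which only the values on `[0,∞)` are constrained or used. -/
structure IsWeight (ω : ℝ → ℝ) : Prop where
  nonneg : ∀ t, 0 ≤ t → 0 ≤ ω t
  continuousOn : ContinuousOn ω (Ici 0)
  monotoneOn : MonotoneOn ω (Ici 0)
  /-- condition (α) -/
  alpha : ∃ K : ℝ, 1 ≤ K ∧ ∀ t, 0 ≤ t → ω (2 * t) ≤ K * (1 + ω t)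
  /-- condition (β) -/
  beta : IntegrableOn (fun t => ω t / t ^ 2) (Ioi 1)
  /-- condition (γ)' -/
  gamma' : ∃ a b : ℝ, 0 < b ∧ ∀ t, 0 ≤ t → a + b * Real.log (1 + t) ≤ ω t
  /-- condition (δ) -/
  delta : ConvexOn ℝ (Ici 0) (fun t => ω (Real.exp t))

/-- The Young conjugate `φ*(y) = sup_{x ≥ 0} (x y - φ(x))` of `φ(x) = ω(eˣ)`. It takes values in
the extended reals: it is `+∞` for large `y` when `ω(t) = log (1 + t)`. -/
def youngConj (ω : ℝ → ℝ) (y : ℝ) : EReal :=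
  ⨆ x : Ici (0 : ℝ), (((x : ℝ) * y - ω (Real.exp x) : ℝ) : EReal)

variable {N : ℕ}

/-- `ω(z) = ω(|z|)` with `|z| = ∑ⱼ |zⱼ|`, for `z ∈ ℂᴺ`. -/
def weightC (ω : ℝ → ℝ) (z : Fin N → ℂ) : ℝ := ω (∑ j, ‖z j‖)

/-- The inclusion `ℝᴺ ⊆ ℂᴺ`. -/
def toC (t : EuclideanSpace ℝ (Fin N)) : Fin N → ℂ := fun j => (t j : ℂ)

/-- The integrand `f(t) e^{-i⟨t,z⟩}`, with `⟨t,z⟩ = ∑ⱼ tⱼ zⱼ`. -/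
def laplaceIntegrand (f : EuclideanSpace ℝ (Fin N) → ℂ) (z : Fin N → ℂ)
    (t : EuclideanSpace ℝ (Fin N)) : ℂ :=
  f t * Complex.exp (-Complex.I * ∑ j, (t j : ℂ) * z j)

/-- The Fourier–Laplace transform `f̂(z) = ∫ f(t) e^{-i⟨t,z⟩} dt`. -/
def fourierLaplace (f : EuclideanSpace ℝ (Fin N) → ℂ) (z : Fin N → ℂ) : ℂ :=
  ∫ t, laplaceIntegrand f z t

/-- The supporting function `H_K(η) = sup_{x ∈ K} ⟨x,η⟩`. -/
def supportFun (K : Set (EuclideanSpace ℝ (Fin N))) (η : Fin N → ℝ) : ℝ :=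
  sSup ((fun x : EuclideanSpace ℝ (Fin N) => ∑ j, x j * η j) '' K)

/-- The partial derivative `∂g/∂xⱼ`. -/
def partialD (j : Fin N) (g : EuclideanSpace ℝ (Fin N) → ℂ) : EuclideanSpace ℝ (Fin N) → ℂ :=
  fun x => fderiv ℝ g x (EuclideanSpace.single j 1)

/-- The derivative `f^{(α)} = ∂₁^{α₁} ⋯ ∂_N^{α_N} f` for a multi-index `α`. -/
def multiD (α : Fin N → ℕ) (f : EuclideanSpace ℝ (Fin N) → ℂ) :
    EuclideanSpace ℝ (Fin N) → ℂ :=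
  (List.finRange N).foldr (fun j g => (partialD j)^[α j] g) f

/-- `𝒟(K)`: smooth functions on `ℝᴺ` with support in `K`. -/
def testFun (K : Set (EuclideanSpace ℝ (Fin N))) : Set (EuclideanSpace ℝ (Fin N) → ℂ) :=
  {f | ContDiff ℝ ((⊤ : ℕ∞) : WithTop ℕ∞) f ∧ tsupport f ⊆ K}

/-- `𝒟_λ(K)`: those `f ∈ 𝒟(K)` with `∫ |f̂(t)| e^{λ ω(t)} dt < ∞`. -/
def testFunLam (ω : ℝ → ℝ) (lam : ℝ) (K : Set (EuclideanSpace ℝ (Fin N))) :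
    Set (EuclideanSpace ℝ (Fin N) → ℂ) :=
  {f | f ∈ testFun K ∧
    ∫⁻ t, ‖fourierLaplace f (toC t)‖ₑ * ENNReal.ofReal (Real.exp (lam * weightC ω (toC t))) < ∞}

/-- `𝒟_(ω)(K)`, the projective limit of the spaces `𝒟_λ(K)` as `λ → ∞`; as a set it is their
intersection. -/
def beurlingTestFun (ω : ℝ → ℝ) (K : Set (EuclideanSpace ℝ (Fin N))) :
    Set (EuclideanSpace ℝ (Fin N) → ℂ) :=
  ⋂ lam ∈ Ioi (0 : ℝ), testFunLam ω lam K

/-- `sup_α sup_x |f^{(α)}(x)| e^{-k φ*(|α|/k)}`, with `e^{-∞} = 0`. -/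
def derivSup (ω : ℝ → ℝ) (k : ℕ) (f : EuclideanSpace ℝ (Fin N) → ℂ) : ℝ≥0∞ :=
  ⨆ (α : Fin N → ℕ) (x : EuclideanSpace ℝ (Fin N)),
    ‖multiD α f x‖ₑ *
      EReal.exp (-(((k : ℝ) : EReal) * youngConj ω (((∑ j, α j : ℕ) : ℝ) / (k : ℝ))))

end PaleyWienerBeurling

end

/-! Put `φ(x) = ω(eˣ)`. Convexity of `φ` makes Young conjugation reversible, so weights `e^{kω(t)}`
and sequences `e^{kφ*(m/k)}` carry the same information up to constants and a change of `k`.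

From (1) to (2): Fourier inversion bounds `f^{(α)}` by the integral of `|t|^{|α|} |f̂(t)|`, and
Young's inequality (`pow_le_exp_youngConj`) trades the power for `e^{kω(t)}`.

From (2) to (3): integration by parts bounds `|z_j|^m |f̂(z)|` by `sup |∂_j^m f|` times `e^{H_K(Im
z)}`. Taking `z_j` a large coordinate and `m` from a subgradient of `φ` at `log |z_j|`
(`exists_nat_youngConj_le`) gives the decay; (α) and (γ)' absorb the losses.

From (3) to (1): since `f̂` converges absolutely on `ℂᴺ`, its restriction to `ℝᴺ + isη` is the
transform of `e^{s⟨t,η⟩} f(t)`, and no contour shift is needed. Inversion yields `|f(x)| e^{s⟨x,η⟩}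
≤ B e^{s H_K(η)}` a.e.; letting `s → ∞` kills `f` outside each supporting half-space
(`GrowthBound.ae_eq_zero`), and Hahn–Banach puts the support in `K`. -/

namespace PaleyWienerBeurling

variable {N : ℕ}

/-! ### Exponentials and the supporting function. -/

/-- The pairing `⟨t,z⟩ = ∑ⱼ tⱼ zⱼ` as a real-linear map in `t`. -/
noncomputable def pairing (z : Fin N → ℂ) : EuclideanSpace ℝ (Fin N) →L[ℝ] ℂ :=
  ∑ j, (EuclideanSpace.proj j : EuclideanSpace ℝ (Fin N) →L[ℝ] ℝ).smulRight (z j)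

theorem pairing_apply (z : Fin N → ℂ) (t : EuclideanSpace ℝ (Fin N)) :
    pairing z t = ∑ j, (t j : ℂ) * z j := by
  simp [pairing]

theorem pairing_single (z : Fin N → ℂ) (j : Fin N) :
    pairing z (EuclideanSpace.single j 1) = z j := by
  rw [pairing_apply, Finset.sum_eq_single j] <;> simp +contextual

theorem laplaceIntegrand_eq (f : EuclideanSpace ℝ (Fin N) → ℂ) (z : Fin N → ℂ)
    (t : EuclideanSpace ℝ (Fin N)) :
    laplaceIntegrand f z t = f t * Complex.exp (-Complex.I * pairing z t) := by
  rw [laplaceIntegrand, pairing_apply]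

theorem norm_exp_pairing (z : Fin N → ℂ) (t : EuclideanSpace ℝ (Fin N)) :
    ‖Complex.exp (-Complex.I * pairing z t)‖ = Real.exp (∑ j, t j * (z j).im) := by
  rw [Complex.norm_exp, pairing_apply]
  simp

theorem hasFDerivAt_exp_pairing (z : Fin N → ℂ) (t : EuclideanSpace ℝ (Fin N)) :
    HasFDerivAt (fun t => Complex.exp (-Complex.I * pairing z t))
      (Complex.exp (-Complex.I * pairing z t) • ((-Complex.I) • pairing z)) t :=
  ((pairing z).hasFDerivAt.const_mul (-Complex.I)).cexp

theorem continuous_exp_pairing (z : Fin N → ℂ) :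
    Continuous (fun t => Complex.exp (-Complex.I * pairing z t)) := by
  fun_prop

theorem le_supportFun {K : Set (EuclideanSpace ℝ (Fin N))} (hK : IsCompact K)
    {x : EuclideanSpace ℝ (Fin N)} (hx : x ∈ K) (η : Fin N → ℝ) :
    ∑ j, x j * η j ≤ supportFun K η :=
  le_csSup (hK.image (by fun_prop)).bddAbove (mem_image_of_mem _ hx)

theorem supportFun_smul {K : Set (EuclideanSpace ℝ (Fin N))} {s : ℝ} (hs : 0 ≤ s)
    (η : Fin N → ℝ) : supportFun K (fun j => s * η j) = s * supportFun K η := by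
  have h : (fun x : EuclideanSpace ℝ (Fin N) => ∑ j, x j * (s * η j)) =
      fun x => s • ∑ j, x j * η j := by
    funext x
    rw [smul_eq_mul, Finset.mul_sum]
    exact Finset.sum_congr rfl fun j _ => by ring
  rw [supportFun, supportFun, h, ← smul_eq_mul, ← Real.sSup_smul_of_nonneg hs, ← image_smul,
    image_image]

/-! ### Fourier–Laplace transforms of test functions. -/

section TestFun

variable {K : Set (EuclideanSpace ℝ (Fin N))} {g : EuclideanSpace ℝ (Fin N) → ℂ}

theorem hasCompactSupport_of_mem_testFun (hK : IsCompact K) (hg : g ∈ testFun K) :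
    HasCompactSupport g :=
  hK.of_isClosed_subset (isClosed_tsupport g) hg.2

theorem partialD_mem_testFun (hg : g ∈ testFun K) (j : Fin N) : partialD j g ∈ testFun K := by
  refine ⟨(hg.1.fderiv_right (m := ((⊤ : ℕ∞) : WithTop ℕ∞)) (by simp)).clm_apply contDiff_const,
    Subset.trans (closure_mono ?_) ((tsupport_fderiv_subset ℝ (f := g)).trans hg.2)⟩
  intro x hx h
  exact hx (by simp [partialD, h])

theorem integrable_laplaceIntegrand (hK : IsCompact K) (hg : g ∈ testFun K) (z : Fin N → ℂ) :
    Integrable (laplaceIntegrand g z) := by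
  simp only [funext (laplaceIntegrand_eq g z)]
  exact (hg.1.continuous.mul (continuous_exp_pairing z)).integrable_of_hasCompactSupport
    (hasCompactSupport_of_mem_testFun hK hg).mul_right

theorem fourierLaplace_partialD (hK : IsCompact K) (hg : g ∈ testFun K) (j : Fin N)
    (z : Fin N → ℂ) :
    fourierLaplace (partialD j g) z = Complex.I * z j * fourierLaplace g z := by
  have hder : ∀ t, fderiv ℝ (fun t => Complex.exp (-Complex.I * pairing z t)) t
      (EuclideanSpace.single j 1) =
      -(Complex.I * z j) * Complex.exp (-Complex.I * pairing z t) := fun t => by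
    rw [(hasFDerivAt_exp_pairing z t).fderiv]
    simp only [smul_apply, pairing_single, smul_eq_mul]
    ring
  have hi := integrable_laplaceIntegrand hK hg z
  have hi' := integrable_laplaceIntegrand hK (partialD_mem_testFun hg j) z
  simp only [funext (laplaceIntegrand_eq g z)] at hi
  simp only [funext (laplaceIntegrand_eq (partialD j g) z)] at hi'
  have key := integral_mul_fderiv_eq_neg_fderiv_mul_of_integrable (μ := volume)
    (f := fun t => Complex.exp (-Complex.I * pairing z t)) (g := g)
    (v := EuclideanSpace.single j (1 : ℝ)) ?_ ?_ ?_ ?_ ?_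
  · simp only [fourierLaplace, laplaceIntegrand_eq]
    calc ∫ t, partialD j g t * Complex.exp (-Complex.I * pairing z t)
        = ∫ t, Complex.exp (-Complex.I * pairing z t) *
          fderiv ℝ g t (EuclideanSpace.single j 1) := by
          simp only [partialD, mul_comm]
      _ = _ := by
          rw [key, ← integral_neg, ← integral_const_mul]
          congr 1 with t
          rw [hder]
          ring
  · refine (hi.const_mul (-(Complex.I * z j))).congr (.of_forall fun t => ?_)
    simp only [hder]
    ring
  · exact hi'.congr (.of_forall fun t => mul_comm _ _)
  · exact hi.congr (.of_forall fun t => mul_comm _ _)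
  · exact fun t _ => (hasFDerivAt_exp_pairing z t).differentiableAt
  · exact fun t _ => hg.1.differentiable (by simp) t

theorem iterate_partialD_mem_and_fourierLaplace (hK : IsCompact K) (hg : g ∈ testFun K)
    (j : Fin N) (n : ℕ) :
    (partialD j)^[n] g ∈ testFun K ∧ ∀ z,
      fourierLaplace ((partialD j)^[n] g) z = (Complex.I * z j) ^ n * fourierLaplace g z := by
  induction n with
  | zero => simpa using hg
  | succ n ih =>
    rw [Function.iterate_succ_apply']
    refine ⟨partialD_mem_testFun ih.1 j, fun z => ?_⟩
    rw [fourierLaplace_partialD hK ih.1, ih.2]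
    ring

theorem multiD_mem_and_fourierLaplace (hK : IsCompact K) (hg : g ∈ testFun K) (α : Fin N → ℕ) :
    multiD α g ∈ testFun K ∧ ∀ z,
      fourierLaplace (multiD α g) z = (∏ j, (Complex.I * z j) ^ α j) * fourierLaplace g z := by
  simp only [Fin.prod_univ_def, multiD]
  -- Both the iterated derivative and the product are now folds over this list, so the induction
  -- runs over an arbitrary list.
  induction List.finRange N with
  | nil => simpa using hg
  | cons j l ih =>
    obtain ⟨h₁, h₂⟩ := iterate_partialD_mem_and_fourierLaplace hK ih.1 j (α j)
    refine ⟨h₁, fun z => ?_⟩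
    rw [List.foldr_cons, h₂, ih.2, List.map_cons, List.prod_cons, mul_assoc]

theorem norm_fourierLaplace_le (hK : IsCompact K) (hg : g ∈ testFun K) {M : ℝ}
    (hM : ∀ x, ‖g x‖ ≤ M) (z : Fin N → ℂ) :
    ‖fourierLaplace g z‖ ≤
      volume.real K * (M * Real.exp (supportFun K (fun j => (z j).im))) := by
  have h := norm_integral_le_of_norm_le (μ := volume) (f := laplaceIntegrand g z)
    (g := K.indicator fun _ => M * Real.exp (supportFun K (fun j => (z j).im))) ?_ ?_
  · rwa [integral_indicator_const _ hK.measurableSet, smul_eq_mul] at h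
  · exact (integrable_indicator_iff hK.measurableSet).2
      (integrableOn_const hK.measure_lt_top.ne)
  · refine .of_forall fun t => ?_
    by_cases ht : t ∈ K
    · rw [indicator_of_mem ht, laplaceIntegrand_eq, norm_mul, norm_exp_pairing]
      have := le_supportFun hK ht (fun j => (z j).im)
      have := (norm_nonneg _).trans (hM t)
      gcongr
      exact hM t
    · have : g t = 0 := image_eq_zero_of_notMem_tsupport fun h => ht (hg.2 h)
      simp [laplaceIntegrand_eq, indicator_of_notMem ht, this]

end TestFun

/-! ### Young conjugation and consequences of the weight axioms. -/

/-- The infimum of the slopes to the right of `s` works. Monotonicity bounds these slopes below by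
`0`, which covers the endpoint `s = 0`, where there are no slopes from the left. -/
theorem exists_nonneg_subgradient {φ : ℝ → ℝ} (hc : ConvexOn ℝ (Ici 0) φ)
    (hm : MonotoneOn φ (Ici 0)) {s : ℝ} (hs : 0 ≤ s) :
    ∃ y, 0 ≤ y ∧ ∀ x, 0 ≤ x → φ s + y * (x - s) ≤ φ x := by
  set S : Set ℝ := (fun x => (φ x - φ s) / (x - s)) '' Ioi s
  have hS : ∀ v ∈ S, 0 ≤ v := by
    rintro _ ⟨x, hx, rfl⟩
    exact div_nonneg (sub_nonneg.2 (hm hs (hs.trans hx.le) hx.le)) (sub_nonneg.2 hx.le)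
  refine ⟨sInf S, Real.sInf_nonneg hS, fun x hx => ?_⟩
  rcases lt_trichotomy x s with h | rfl | h
  · have : (φ s - φ x) / (s - x) ≤ sInf S := by
      refine le_csInf (nonempty_Ioi.image _) ?_
      rintro _ ⟨w, hw, rfl⟩
      exact hc.slope_mono_adjacent hx (hs.trans hw.le) h hw
    rw [div_le_iff₀ (sub_pos.2 h)] at this
    linarith
  · simp
  · have : sInf S ≤ (φ x - φ s) / (x - s) := csInf_le ⟨0, hS⟩ (mem_image_of_mem _ h)
    rw [le_div_iff₀ (sub_pos.2 h)] at this
    linarith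

theorem le_youngConj (ω : ℝ → ℝ) (y : ℝ) {x : ℝ} (hx : 0 ≤ x) :
    ((x * y - ω (Real.exp x) : ℝ) : EReal) ≤ youngConj ω y :=
  le_iSup (fun x : Ici (0 : ℝ) => (((x : ℝ) * y - ω (Real.exp x) : ℝ) : EReal)) ⟨x, hx⟩

theorem youngConj_ne_bot (ω : ℝ → ℝ) (y : ℝ) : youngConj ω y ≠ ⊥ :=
  ne_bot_of_le_ne_bot (EReal.coe_ne_bot _) (le_youngConj ω y le_rfl)

theorem weightC_mono {ω : ℝ → ℝ} (hω : IsWeight ω) {z w : Fin N → ℂ}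
    (h : ∀ j, ‖z j‖ ≤ ‖w j‖) : weightC ω z ≤ weightC ω w :=
  hω.monotoneOn (Finset.sum_nonneg fun _ _ => norm_nonneg _)
    (Finset.sum_nonneg fun _ _ => norm_nonneg _) (Finset.sum_le_sum fun j _ => h j)

namespace IsWeight

variable {ω : ℝ → ℝ}

theorem monotoneOn_exp (hω : IsWeight ω) : MonotoneOn (fun t => ω (Real.exp t)) (Ici 0) :=
  fun _ _ _ _ h =>
    hω.monotoneOn (Real.exp_pos _).le (Real.exp_pos _).le (Real.exp_le_exp.2 h)

/-- Integer multiples of `1 / k` suffice to recover `ω` from its Young conjugate, up to a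
factor `t`. -/
theorem exists_nat_youngConj_le (hω : IsWeight ω) {k : ℕ} (hk : 1 ≤ k) {t : ℝ} (ht : 1 ≤ t) :
    ∃ m : ℕ, ∃ r : ℝ, youngConj ω (m / k) = r ∧
      Real.exp (k * r) ≤ t * Real.exp (-(k * ω t)) * t ^ m := by
  have ht0 : 0 < t := by linarith
  have hk0 : (0 : ℝ) < k := by exact_mod_cast hk
  have hs : 0 ≤ Real.log t := Real.log_nonneg ht
  obtain ⟨y, hy, hsub⟩ := exists_nonneg_subgradient hω.delta hω.monotoneOn_exp hs
  simp only [Real.exp_log ht0] at hsub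
  -- Rounding down keeps `m / k ≤ y`, hence `φ*(m/k) ≤ φ*(y) = y log t - φ(log t)`, which is finite;
  -- the rounding error below `1` costs the factor `t`.
  set m := ⌊k * y⌋₊
  have hm₁ : (m : ℝ) ≤ k * y := Nat.floor_le (by positivity)
  have hm₂ : k * y < m + 1 := Nat.lt_floor_add_one _
  have hmy : (m : ℝ) / k ≤ y := by rw [div_le_iff₀ hk0]; linarith
  have hle : youngConj ω (m / k) ≤ ((Real.log t * y - ω t : ℝ) : EReal) := by
    refine iSup_le fun x => EReal.coe_le_coe_iff.2 ?_
    have h₁ := hsub x x.2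
    have h₂ := mul_le_mul_of_nonneg_left hmy x.2
    linarith
  have hr : ((youngConj ω (m / k)).toReal : EReal) = youngConj ω (m / k) :=
    EReal.coe_toReal (ne_top_of_le_ne_top (EReal.coe_ne_top _) hle) (youngConj_ne_bot _ _)
  refine ⟨m, _, hr.symm, ?_⟩
  rw [← hr, EReal.coe_le_coe_iff] at hle
  generalize (youngConj ω (m / k)).toReal = r at hle
  calc Real.exp (k * r) ≤ Real.exp (Real.log t + -(k * ω t) + Real.log t * m) := by
        apply Real.exp_le_exp.2
        have h₁ := mul_le_mul_of_nonneg_left hle hk0.le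
        have h₂ := mul_le_mul_of_nonneg_left hm₂.le hs
        linarith
    _ = _ := by
        rw [Real.exp_add, Real.exp_add, Real.exp_log ht0, Real.exp_mul, Real.exp_log ht0,
          Real.rpow_natCast]

/-- Young's inequality at `x = log t`, multiplied by `k`. For `t < 1` this `x` is out of range;
there `t ^ m ≤ 1`, and `φ* ≥ -ω(1)` explains the factor `e^{kω(1)}`. -/
theorem pow_le_exp_youngConj (hω : IsWeight ω) {k : ℕ} (hk : 1 ≤ k) {m : ℕ} {r : ℝ}
    (hr : youngConj ω (m / k) = r) {t : ℝ} (ht : 0 ≤ t) :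
    t ^ m ≤ Real.exp (k * r) * Real.exp (k * ω 1) * Real.exp (k * ω t) := by
  have hk0 : (0 : ℝ) < k := by exact_mod_cast hk
  have h1 := hω.nonneg 1 zero_le_one
  have h2 := hω.nonneg t ht
  rw [← Real.exp_add, ← Real.exp_add]
  rcases le_or_gt 1 t with h | h
  · have ht0 : 0 < t := by linarith
    have := le_youngConj ω (m / k) (Real.log_nonneg h)
    rw [hr, EReal.coe_le_coe_iff, Real.exp_log ht0] at this
    have h3 := mul_le_mul_of_nonneg_left this hk0.le
    rw [← Real.rpow_natCast, Real.rpow_def_of_pos ht0]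
    apply Real.exp_le_exp.2
    have h4 : k * (Real.log t * (m / k) - ω t) = Real.log t * m - k * ω t := by
      field_simp
    have h5 := mul_nonneg hk0.le h1
    linarith
  · have := le_youngConj ω (m / k) le_rfl
    rw [hr, EReal.coe_le_coe_iff, Real.exp_zero] at this
    refine (pow_le_one₀ ht h.le).trans (Real.one_le_exp ?_)
    have h3 := mul_le_mul_of_nonneg_left this hk0.le
    have h4 := mul_nonneg hk0.le h2
    linarith

theorem exists_dilation_le (hω : IsWeight ω) (n : ℕ) :
    ∃ A : ℝ, 0 ≤ A ∧ ∀ t, 0 ≤ t → ω (n * t) ≤ A * (1 + ω t) := by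
  obtain ⟨L, hL, h⟩ := hω.alpha
  have key : ∀ n : ℕ, ∃ A : ℝ, 0 ≤ A ∧ ∀ t, 0 ≤ t → ω (2 ^ n * t) ≤ A * (1 + ω t) := by
    intro n
    induction n with
    | zero => exact ⟨1, zero_le_one, fun t ht => by simp⟩
    | succ n ih =>
      obtain ⟨A, hA, ih⟩ := ih
      refine ⟨L * (1 + A), by positivity, fun t ht => ?_⟩
      have h₁ := h (2 ^ n * t) (by positivity)
      have h₂ := ih t ht
      have h₃ := hω.nonneg t ht
      calc ω (2 ^ (n + 1) * t) = ω (2 * (2 ^ n * t)) := by ring_nf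
        _ ≤ L * (1 + ω (2 ^ n * t)) := h₁
        _ ≤ L * ((1 + ω t) + A * (1 + ω t)) := by gcongr; linarith
        _ = _ := by ring
  obtain ⟨A, hA, h⟩ := key n
  refine ⟨A, hA, fun t ht => (hω.monotoneOn ?_ ?_ ?_).trans (h t ht)⟩
  · exact mem_Ici.2 (by positivity)
  · exact mem_Ici.2 (by positivity)
  · gcongr
    exact_mod_cast Nat.lt_two_pow_self.le

/-- By (γ)', `e^{-Mω}` decays like the power `-Mb`, so any `M ≥ r / b` serves. -/
theorem exists_exp_neg_weightC_le (hω : IsWeight ω) (r : ℝ) :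
    ∃ M : ℕ, ∃ C : ℝ, 0 < C ∧ ∀ t : EuclideanSpace ℝ (Fin N),
      Real.exp (-(M * weightC ω (toC t))) ≤ C * (1 + ‖t‖) ^ (-r) := by
  obtain ⟨a, b, hb, h⟩ := hω.gamma'
  obtain ⟨M, hM⟩ := exists_nat_ge (r / b)
  rw [div_le_iff₀ hb] at hM
  refine ⟨M, Real.exp (-(M * a)), Real.exp_pos _, fun t => ?_⟩
  have hn : ‖t‖ ≤ ∑ j, ‖toC t j‖ := by
    rw [EuclideanSpace.norm_eq]
    refine Real.sqrt_le_iff.2 ⟨Finset.sum_nonneg fun _ _ => norm_nonneg _, ?_⟩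
    simpa only [toC, Complex.norm_real] using
      Finset.sum_sq_le_sq_sum_of_nonneg (s := Finset.univ) (f := fun j => ‖t j‖)
        fun _ _ => norm_nonneg _
  have h0 : 0 ≤ ‖t‖ := norm_nonneg t
  have hlog : 0 ≤ Real.log (1 + ‖t‖) := Real.log_nonneg (by linarith)
  have hle : a + b * Real.log (1 + ‖t‖) ≤ weightC ω (toC t) :=
    (h _ h0).trans (hω.monotoneOn h0 (h0.trans hn) hn)
  rw [Real.rpow_def_of_pos (by linarith), ← Real.exp_add]
  apply Real.exp_le_exp.2
  have h₁ := mul_le_mul_of_nonneg_left hle (Nat.cast_nonneg M)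
  have h₂ := mul_le_mul_of_nonneg_right hM hlog
  linarith

end IsWeight

/-! ### Fourier inversion and normalisation. -/

open scoped FourierTransform

section Inversion

variable {V : Type*} [NormedAddCommGroup V] [InnerProductSpace ℝ V] [FiniteDimensional ℝ V]
  [MeasurableSpace V] [BorelSpace V] {f : V → ℂ}

theorem continuous_fourier_of_integrable (hf : Integrable f) : Continuous (𝓕 f) :=
  VectorFourier.fourierIntegral_continuous Real.continuous_fourierChar
    (L := innerₗ V) continuous_inner hf

theorem continuous_fourierInv_of_integrable (hf : Integrable f) : Continuous (𝓕⁻ f) := by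
  have h : 𝓕⁻ f = fun v => 𝓕 f (-v) := funext fun v => Real.fourierInv_eq_fourier_neg f v
  rw [h]
  exact (continuous_fourier_of_integrable hf).comp continuous_neg

theorem norm_fourierInv_le_integral_norm (f : V → ℂ) (v : V) : ‖𝓕⁻ f v‖ ≤ ∫ w, ‖f w‖ := by
  rw [Real.fourierInv_eq_fourier_neg]
  exact VectorFourier.norm_fourierIntegral_le_integral_norm _ _ _ _ _

/-- Fourier inversion for an integrable function with integrable Fourier transform, without
continuity assumption. -/
theorem ae_eq_fourierInv_fourier (hf : Integrable f) (hf' : Integrable (𝓕 f)) :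
    f =ᵐ[volume] 𝓕⁻ (𝓕 f) := by
  refine ae_eq_of_integral_contDiff_smul_eq hf.locallyIntegrable
    (continuous_fourierInv_of_integrable hf').locallyIntegrable fun ψ hψ hψc => ?_
  have hsm : ContDiff ℝ ((⊤ : ℕ∞) : WithTop ℕ∞) fun v => (ψ v : ℂ) :=
    Complex.ofRealCLM.contDiff.comp hψ
  have hcs : HasCompactSupport fun v => (ψ v : ℂ) := hψc.comp_left Complex.ofReal_zero
  let Ψ : SchwartzMap V ℂ := hcs.toSchwartzMap hsm
  have hΨ : ∀ v, Ψ v = (ψ v : ℂ) := fun v => rfl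
  -- By duality, `∫ ψ f = ∫ 𝓕(𝓕⁻ψ) f = ∫ 𝓕⁻ψ 𝓕f = ∫ ψ 𝓕⁻(𝓕f)`; inversion is needed only for the
  -- Schwartz function `ψ`.
  have h₁ : ∫ v, 𝓕 (𝓕⁻ Ψ) v • f v = ∫ v, (𝓕⁻ Ψ) v • 𝓕 f v := by
    have := VectorFourier.integral_fourierIntegral_smul_eq_flip (L := innerₗ V)
      Real.continuous_fourierChar continuous_inner ((𝓕⁻ Ψ).integrable (μ := volume)) hf
    rw [flip_innerₗ] at this
    exact this
  have h₂ : ∫ v, (𝓕⁻ Ψ) v • 𝓕 f v = ∫ v, Ψ v • 𝓕⁻ (𝓕 f) v := by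
    -- The inverse transform is the transform for the pairing `-⟨·,·⟩`, so the same flip identity
    -- applies.
    have hc : Continuous fun p : V × V => (-innerₗ V) p.1 p.2 := continuous_inner.neg
    have hflip : (-innerₗ V).flip = -innerₗ V := by
      ext x y
      simp [real_inner_comm]
    have := VectorFourier.integral_fourierIntegral_smul_eq_flip (L := -innerₗ V)
      Real.continuous_fourierChar hc (Ψ.integrable (μ := volume)) hf'
    rw [hflip] at this
    rw [SchwartzMap.fourierInv_coe]
    exact this
  rw [FourierTransform.fourier_fourierInv_eq] at h₁
  simpa [hΨ] using h₁.trans h₂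

end Inversion

theorem fourier_eq_fourierLaplace (f : EuclideanSpace ℝ (Fin N) → ℂ)
    (w : EuclideanSpace ℝ (Fin N)) :
    𝓕 f w = fourierLaplace f (toC ((2 * Real.pi) • w)) := by
  rw [Real.fourier_eq', fourierLaplace]
  congr 1 with t
  rw [laplaceIntegrand, smul_eq_mul, mul_comm]
  congr 2
  simp only [PiLp.inner_apply, toC, PiLp.smul_apply, smul_eq_mul, RCLike.inner_apply, conj_trivial]
  push_cast
  rw [Finset.mul_sum, Finset.sum_mul, Finset.mul_sum]
  exact Finset.sum_congr rfl fun j _ => by ring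

/-- Turns a complex translate of `f̂` into the transform of an exponentially weighted `f`. -/
theorem laplaceIntegrand_laplaceIntegrand (f : EuclideanSpace ℝ (Fin N) → ℂ)
    (z w : Fin N → ℂ) :
    laplaceIntegrand (laplaceIntegrand f z) w = laplaceIntegrand f (z + w) := by
  funext t
  simp only [laplaceIntegrand, Pi.add_apply, mul_add, Finset.sum_add_distrib, Complex.exp_add]
  ring

theorem fourierLaplace_congr_ae {f g : EuclideanSpace ℝ (Fin N) → ℂ} (h : f =ᵐ[volume] g)
    (z : Fin N → ℂ) : fourierLaplace f z = fourierLaplace g z :=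
  integral_congr_ae (h.mono fun t ht => by simp only [laplaceIntegrand, ht])

/-! ### From weighted integrability of the transform to derivative bounds. -/

variable {ω : ℝ → ℝ} {K : Set (EuclideanSpace ℝ (Fin N))}

theorem norm_prod_pow_toC_le (α : Fin N → ℕ) (t : EuclideanSpace ℝ (Fin N)) :
    ‖∏ j, (Complex.I * toC t j) ^ α j‖ ≤ (∑ j, ‖toC t j‖) ^ (∑ j, α j) := by
  rw [norm_prod, ← Finset.prod_pow_eq_pow_sum]
  refine Finset.prod_le_prod (fun _ _ => norm_nonneg _) fun j _ => ?_
  rw [norm_pow, norm_mul, Complex.norm_I, one_mul]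
  gcongr
  exact Finset.single_le_sum (f := fun j => ‖toC t j‖) (fun _ _ => norm_nonneg _)
    (Finset.mem_univ j)

theorem lintegral_comp_const_smul_lt_top {F : EuclideanSpace ℝ (Fin N) → ℝ≥0∞} {c : ℝ}
    (hc : c ≠ 0) (hF : ∫⁻ t, F t < ∞) : ∫⁻ t, F (c • t) < ∞ := by
  have h := lintegral_map_equiv (μ := volume) F
    (Homeomorph.smulOfNeZero (α := EuclideanSpace ℝ (Fin N)) c hc).toMeasurableEquiv
  have h' : ∫⁻ t, F (c • t) =
      ∫⁻ t, F t ∂(Measure.map (c • · : EuclideanSpace ℝ (Fin N) → _) volume) := h.symm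
  rw [h', Measure.map_addHaar_smul _ hc, lintegral_smul_measure]
  exact ENNReal.mul_lt_top ENNReal.ofReal_lt_top hF

theorem derivSup_lt_top (hω : IsWeight ω) (hK : IsCompact K)
    {g : EuclideanSpace ℝ (Fin N) → ℂ} (hg : g ∈ beurlingTestFun ω K) {k : ℕ} (hk : 1 ≤ k) :
    derivSup ω k g < ∞ := by
  have hk0 : (0 : ℝ) < k := by exact_mod_cast hk
  obtain ⟨hgK, hint⟩ : g ∈ testFunLam ω k K := mem_iInter₂.1 hg k hk0
  set G : EuclideanSpace ℝ (Fin N) → ℝ≥0∞ := fun t =>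
    ‖fourierLaplace g (toC t)‖ₑ * ENNReal.ofReal (Real.exp (k * weightC ω (toC t)))
  set B : ℝ≥0∞ := ENNReal.ofReal (Real.exp (k * ω 1)) * ∫⁻ w, G ((2 * Real.pi) • w)
  have hB : B < ∞ := ENNReal.mul_lt_top ENNReal.ofReal_lt_top
    (lintegral_comp_const_smul_lt_top (by positivity) hint)
  refine lt_of_le_of_lt (iSup₂_le fun α x => ?_) hB
  induction hy : youngConj ω (((∑ j, α j : ℕ) : ℝ) / (k : ℝ)) with
  | bot => exact absurd hy (youngConj_ne_bot _ _)
  -- Here the weight is `e^{-∞} = 0`, so the term vanishes.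
  | top => rw [EReal.coe_mul_top_of_pos hk0]; simp
  | coe r =>
    obtain ⟨hα, hαt⟩ := multiD_mem_and_fourierLaplace hK hgK α
    have hinv : 𝓕⁻ (𝓕 (multiD α g)) = multiD α g := by
      let S : SchwartzMap (EuclideanSpace ℝ (Fin N)) ℂ :=
        (hasCompactSupport_of_mem_testFun hK hα).toSchwartzMap hα.1
      exact S.continuous.fourierInv_fourier_eq S.integrable (𝓕 S).integrable
    have hbound : ‖multiD α g x‖ₑ ≤ ENNReal.ofReal (Real.exp (k * r)) * B := by
      rw [← hinv, Real.fourierInv_eq]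
      refine (enorm_integral_le_lintegral_enorm _).trans ?_
      rw [← mul_assoc, ← lintegral_const_mul' _ _ (by finiteness)]
      refine lintegral_mono fun w => ?_
      rw [fourier_eq_fourierLaplace, hαt]
      simp only [G]
      generalize (2 * Real.pi) • w = t
      have hpow := (norm_prod_pow_toC_le α t).trans
        (hω.pow_le_exp_youngConj hk hy (Finset.sum_nonneg fun _ _ => norm_nonneg _))
      rw [← ofReal_norm, ← ofReal_norm,
        ← ENNReal.ofReal_mul (by positivity), ← ENNReal.ofReal_mul (by positivity),
        ← ENNReal.ofReal_mul (by positivity)]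
      apply ENNReal.ofReal_le_ofReal
      rw [Circle.norm_smul, norm_mul]
      refine (mul_le_mul_of_nonneg_right hpow (norm_nonneg _)).trans_eq ?_
      rw [weightC]
      ring
    have hexp : EReal.exp (-(((k : ℝ) : EReal) * (r : EReal))) =
        ENNReal.ofReal (Real.exp (-(k * r))) := by
      rw [← EReal.coe_mul, ← EReal.coe_neg, EReal.exp_coe]
    rw [hexp]
    calc _ ≤ ENNReal.ofReal (Real.exp (k * r)) * B * ENNReal.ofReal (Real.exp (-(k * r))) := by
          gcongr
      _ = ENNReal.ofReal (Real.exp (k * r) * Real.exp (-(k * r))) * B := by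
          rw [ENNReal.ofReal_mul (by positivity)]; ring
      _ = B := by rw [← Real.exp_add, add_neg_cancel]; simp

/-! ### From derivative bounds to growth of the transform. -/

theorem exists_norm_multiD_le {g : EuclideanSpace ℝ (Fin N) → ℂ} {k : ℕ}
    (h : derivSup ω k g < ∞) :
    ∃ D : ℝ, 0 ≤ D ∧ ∀ (α : Fin N → ℕ) (r : ℝ),
      youngConj ω (((∑ j, α j : ℕ) : ℝ) / (k : ℝ)) = r →
        ∀ x, ‖multiD α g x‖ ≤ D * Real.exp (k * r) := by
  refine ⟨(derivSup ω k g).toReal, ENNReal.toReal_nonneg, fun α r hr x => ?_⟩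
  have h₁ : ‖multiD α g x‖ₑ * ENNReal.ofReal (Real.exp (-(k * r))) ≤ derivSup ω k g := by
    have := le_iSup₂ (f := fun (α : Fin N → ℕ) (x : EuclideanSpace ℝ (Fin N)) =>
      ‖multiD α g x‖ₑ *
        EReal.exp (-(((k : ℝ) : EReal) * youngConj ω (((∑ j, α j : ℕ) : ℝ) / (k : ℝ))))) α x
    simp only [hr] at this
    rwa [← EReal.coe_mul, ← EReal.coe_neg, EReal.exp_coe] at this
  have h₂ := ENNReal.toReal_mono h.ne h₁
  rw [ENNReal.toReal_mul, toReal_enorm, ENNReal.toReal_ofReal (Real.exp_pos _).le, Real.exp_neg,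
    ← div_eq_mul_inv, div_le_iff₀ (Real.exp_pos _)] at h₂
  exact h₂

theorem exists_norm_fourierLaplace_le (hω : IsWeight ω) (hK : IsCompact K)
    {g : EuclideanSpace ℝ (Fin N) → ℂ} (hg : g ∈ testFun K)
    (hd : ∀ k : ℕ, 1 ≤ k → derivSup ω k g < ∞) (k : ℕ) :
    ∃ C : ℝ, 0 < C ∧ ∀ z : Fin N → ℂ, ‖fourierLaplace g z‖ ≤
      C * Real.exp (supportFun K (fun j => (z j).im) - k * weightC ω z) := by
  obtain ⟨A, hA, hdil⟩ := hω.exists_dilation_le N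
  obtain ⟨a, b, hb, hlog⟩ := hω.gamma'
  -- `k * A` pays for passing from `|z_j|` to `|z|`, and `1 / b` for the extra factor `t`.
  obtain ⟨l, hl⟩ := exists_nat_ge (k * A + 1 / b)
  have hl0 : 0 < k * A + 1 / b := by positivity
  have hl1 : 1 ≤ l := by
    have : (0 : ℝ) < l := hl0.trans_le hl
    exact_mod_cast this
  obtain ⟨D, hD, hDb⟩ := exists_norm_multiD_le (hd l hl1)
  obtain ⟨M, hM⟩ := (hg.1.continuous.bounded_above_of_compact_support
    (hasCompactSupport_of_mem_testFun hK hg))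
  set v := volume.real K
  have hv : 0 ≤ v := measureReal_nonneg
  have hM0 : 0 ≤ M := (norm_nonneg _).trans (hM 0)
  set C₁ := v * M * Real.exp (k * ω N)
  set C₂ := v * D * Real.exp (k * A - a / b)
  refine ⟨C₁ + C₂ + 1, by positivity, fun z => ?_⟩
  set H := supportFun K (fun j => (z j).im)
  rw [sub_eq_add_neg, Real.exp_add, mul_comm (Real.exp H), ← mul_assoc]
  have hsum : 0 ≤ ∑ j, ‖z j‖ := Finset.sum_nonneg fun _ _ => norm_nonneg _
  have hN : (0 : ℝ) ≤ N := Nat.cast_nonneg N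
  -- On this bounded region `ω` is bounded and the sup bound on `g` suffices. Outside it, some
  -- coordinate has modulus at least `1`, as the Young estimate requires.
  by_cases hz : ∑ j, ‖z j‖ ≤ N
  · have hw : weightC ω z ≤ ω N := hω.monotoneOn hsum hN hz
    calc ‖fourierLaplace g z‖ ≤ v * (M * Real.exp H) := norm_fourierLaplace_le hK hg hM z
      _ ≤ v * (M * Real.exp H) * Real.exp (k * ω N + -(k * weightC ω z)) := by
          refine le_mul_of_one_le_right (by positivity) (Real.one_le_exp ?_)
          have := mul_le_mul_of_nonneg_left hw (Nat.cast_nonneg (α := ℝ) k)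
          linarith
      _ = C₁ * Real.exp (-(k * weightC ω z)) * Real.exp H := by rw [Real.exp_add]; ring
      _ ≤ _ := by
          gcongr
          have : 0 ≤ C₂ := by positivity
          linarith
  · rw [not_le] at hz
    obtain ⟨j, hj⟩ : ∃ j, (∑ j, ‖z j‖) ≤ N * ‖z j‖ := by
      by_contra! hcon
      have hne : (Finset.univ : Finset (Fin N)).Nonempty := by
        rw [Finset.nonempty_iff_ne_empty]
        intro he
        rw [he] at hz
        simp only [Finset.sum_empty] at hz
        linarith
      have h₁ := Finset.sum_lt_sum_of_nonempty hne fun j _ => hcon j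
      rw [← Finset.mul_sum, Finset.sum_const, Finset.card_univ, Fintype.card_fin, nsmul_eq_mul]
        at h₁
      exact lt_irrefl _ h₁
    set t := ‖z j‖
    have ht : 1 ≤ t := by
      by_contra! h
      have := mul_le_mul_of_nonneg_left h.le hN
      linarith
    have ht0 : 0 < t := by linarith
    have hωt := hω.nonneg t ht0.le
    obtain ⟨m, r, hr, hmr⟩ := hω.exists_nat_youngConj_le hl1 ht
    have hαs : ∑ i, (Pi.single j m : Fin N → ℕ) i = m := by simp
    obtain ⟨hα, hαt⟩ := multiD_mem_and_fourierLaplace hK hg (Pi.single j m)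
    have hprod : ‖∏ i, (Complex.I * z i) ^ (Pi.single j m : Fin N → ℕ) i‖ = t ^ m := by
      rw [Finset.prod_eq_single j (fun i _ hi => by simp [hi]) (by simp)]
      simp [t]
    have h₁ := norm_fourierLaplace_le hK hα (hDb _ r (by rw [hαs]; exact hr)) z
    rw [hαt, norm_mul, hprod] at h₁
    have h₂ : ‖fourierLaplace g z‖ ≤ v * (D * (t * Real.exp (-(l * ω t))) * Real.exp H) := by
      refine le_of_mul_le_mul_left (h₁.trans ?_) (pow_pos ht0 m)
      calc _ ≤ v * (D * (t * Real.exp (-(l * ω t)) * t ^ m) * Real.exp H) := by gcongr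
        _ = _ := by ring
    have h₃ : t * Real.exp (-(l * ω t)) ≤
        Real.exp (k * A - a / b) * Real.exp (-(k * weightC ω z)) := by
      have hw : weightC ω z ≤ A * (1 + ω t) :=
        (hω.monotoneOn hsum (by positivity : (0 : ℝ) ≤ N * t) hj).trans (hdil t ht0.le)
      have hlt : Real.log t ≤ (ω t - a) / b := by
        rw [le_div_iff₀ hb]
        have h₄ := hlog t ht0.le
        have h₅ := mul_le_mul_of_nonneg_left
          (Real.log_le_log ht0 (by linarith : t ≤ 1 + t)) hb.le
        linarith
      nth_rewrite 1 [← Real.exp_log ht0]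
      rw [← Real.exp_add, ← Real.exp_add]
      apply Real.exp_le_exp.2
      have h₄ := mul_le_mul_of_nonneg_left hw (Nat.cast_nonneg (α := ℝ) k)
      have h₅ := mul_le_mul_of_nonneg_right hl hωt
      have h₆ : (ω t - a) / b = 1 / b * ω t - a / b := by ring
      linarith
    calc ‖fourierLaplace g z‖ ≤ v * (D * (t * Real.exp (-(l * ω t))) * Real.exp H) := h₂
      _ ≤ v * (D * (Real.exp (k * A - a / b) * Real.exp (-(k * weightC ω z))) * Real.exp H) := by
          gcongr
      _ = C₂ * Real.exp (-(k * weightC ω z)) * Real.exp H := by ring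
      _ ≤ _ := by
          gcongr
          have : 0 ≤ C₁ := by positivity
          linarith

/-! ### From growth of the transform to support and regularity. -/

variable {f : EuclideanSpace ℝ (Fin N) → ℂ}

/-- The vector `i s η`. -/
noncomputable def imagPoint (s : ℝ) (η : Fin N → ℝ) : Fin N → ℂ :=
  fun j => Complex.I * ((s * η j : ℝ) : ℂ)

theorem norm_laplaceIntegrand_imagPoint (s : ℝ) (η : Fin N → ℝ)
    (t : EuclideanSpace ℝ (Fin N)) :
    ‖laplaceIntegrand f (imagPoint s η) t‖ = ‖f t‖ * Real.exp (s * ∑ j, t j * η j) := by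
  rw [laplaceIntegrand_eq, norm_mul, norm_exp_pairing, Finset.mul_sum]
  congr 3 with j
  simp [imagPoint]
  ring

/-- The growth condition `|f̂(z)| ≤ C_k exp (H_K(Im z) - k ω(z))` for all `k`. -/
def GrowthBound (ω : ℝ → ℝ) (K : Set (EuclideanSpace ℝ (Fin N)))
    (f : EuclideanSpace ℝ (Fin N) → ℂ) : Prop :=
  ∀ k : ℕ, 1 ≤ k → ∃ C : ℝ, 0 < C ∧ ∀ z : Fin N → ℂ,
    ‖fourierLaplace f z‖ ≤ C * Real.exp (supportFun K (fun j => (z j).im) - k * weightC ω z)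

/-- On each horizontal shift `ℝᴺ + i s η` the transform decays rapidly, uniformly in `s` up to the
factor `exp (s H_K(η))`, even after multiplication by `exp (λ ω)`. -/
theorem GrowthBound.exists_decay (hω : IsWeight ω) (h : GrowthBound ω K f) (lam r : ℝ) :
    ∃ C : ℝ, 0 < C ∧ ∀ (s : ℝ) (η : Fin N → ℝ) (t : EuclideanSpace ℝ (Fin N)), 0 ≤ s →
      ‖fourierLaplace f (imagPoint s η + toC t)‖ * Real.exp (lam * weightC ω (toC t)) ≤
        C * Real.exp (s * supportFun K η) * (1 + ‖t‖) ^ (-r) := by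
  obtain ⟨M, C₁, hC₁, hM⟩ := hω.exists_exp_neg_weightC_le (N := N) r
  obtain ⟨l, hl⟩ := exists_nat_ge lam
  -- `M` buys the power decay, `l` absorbs `lam`, and `+ 1` only ensures a positive index.
  obtain ⟨C₂, hC₂, hb⟩ := h (M + l + 1) (by omega)
  refine ⟨C₂ * C₁, by positivity, fun s η t hs => ?_⟩
  have him : (fun j => ((imagPoint s η + toC t) j).im) = fun j => s * η j := by
    funext j
    simp [imagPoint, toC]
  have hre : weightC ω (toC t) ≤ weightC ω (imagPoint s η + toC t) := by
    refine weightC_mono hω fun j => ?_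
    have h₁ : ((imagPoint s η + toC t) j).re = t j := by simp [imagPoint, toC]
    have h₂ := Complex.abs_re_le_norm ((imagPoint s η + toC t) j)
    rw [h₁] at h₂
    simpa [toC] using h₂
  have hw : 0 ≤ weightC ω (toC t) := hω.nonneg _ (Finset.sum_nonneg fun _ _ => norm_nonneg _)
  have hz := hb (imagPoint s η + toC t)
  rw [him, supportFun_smul hs] at hz
  calc _ ≤ C₂ * Real.exp (s * supportFun K η -
          ((M + l + 1 : ℕ) : ℝ) * weightC ω (imagPoint s η + toC t)) *
          Real.exp (lam * weightC ω (toC t)) := by gcongr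
    _ ≤ C₂ * (Real.exp (s * supportFun K η) * Real.exp (-(M * weightC ω (toC t)))) := by
        rw [mul_assoc, ← Real.exp_add, ← Real.exp_add]
        refine mul_le_mul_of_nonneg_left (Real.exp_le_exp.2 ?_) hC₂.le
        have h₁ := mul_le_mul_of_nonneg_left hre (Nat.cast_nonneg (α := ℝ) (M + l + 1))
        have h₂ := mul_le_mul_of_nonneg_right hl hw
        push_cast at h₁ ⊢
        linarith
    _ ≤ C₂ * (Real.exp (s * supportFun K η) * (C₁ * (1 + ‖t‖) ^ (-r))) := by
        gcongr
        exact hM t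
    _ = _ := by ring

theorem integrable_one_add_norm_succ :
    Integrable fun t : EuclideanSpace ℝ (Fin N) => (1 + ‖t‖) ^ (-(N + 1 : ℝ)) :=
  integrable_one_add_norm (by simp)

theorem GrowthBound.exists_fourier_decay (hω : IsWeight ω) (h : GrowthBound ω K f) {r : ℝ}
    (hr : 0 ≤ r) :
    ∃ C : ℝ, 0 < C ∧ ∀ (s : ℝ) (η : Fin N → ℝ) (w : EuclideanSpace ℝ (Fin N)), 0 ≤ s →
      ‖𝓕 (laplaceIntegrand f (imagPoint s η)) w‖ ≤
        C * Real.exp (s * supportFun K η) * (1 + ‖w‖) ^ (-r) := by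
  obtain ⟨C, hC, hb⟩ := h.exists_decay hω 0 r
  refine ⟨C, hC, fun s η w hs => ?_⟩
  have h₁ := hb s η ((2 * Real.pi) • w) hs
  rw [zero_mul, Real.exp_zero, mul_one] at h₁
  rw [fourier_eq_fourierLaplace, fourierLaplace, laplaceIntegrand_laplaceIntegrand]
  refine h₁.trans ?_
  have h₂ : ‖w‖ ≤ ‖(2 * Real.pi) • w‖ := by
    rw [norm_smul, Real.norm_of_nonneg (by positivity)]
    exact le_mul_of_one_le_left (norm_nonneg _) (by linarith [Real.pi_gt_three])
  have h₃ : 0 < 1 + ‖w‖ := by positivity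
  refine mul_le_mul_of_nonneg_left ?_ (by positivity)
  exact Real.rpow_le_rpow_of_nonpos h₃ (by linarith) (by linarith)

theorem GrowthBound.integrable_fourier (hω : IsWeight ω) (h : GrowthBound ω K f)
    (hi : ∀ z, Integrable (laplaceIntegrand f z)) {s : ℝ} (hs : 0 ≤ s) (η : Fin N → ℝ) (n : ℕ) :
    Integrable fun w => ‖w‖ ^ n * ‖𝓕 (laplaceIntegrand f (imagPoint s η)) w‖ := by
  -- `n` powers cancel the moment; `N + 1` leave an integrable majorant.
  obtain ⟨C, hC, hb⟩ := h.exists_fourier_decay hω (r := N + 1 + n) (by positivity)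
  have hcont := continuous_fourier_of_integrable (hi (imagPoint s η))
  refine ((integrable_one_add_norm_succ (N := N)).const_mul
    (C * Real.exp (s * supportFun K η))).mono'
      (Continuous.aestronglyMeasurable (by fun_prop)) (.of_forall fun w => ?_)
  have h₀ : 0 < 1 + ‖w‖ := by positivity
  rw [norm_mul, norm_norm, norm_pow, norm_norm]
  calc ‖w‖ ^ n * ‖𝓕 (laplaceIntegrand f (imagPoint s η)) w‖
      ≤ (1 + ‖w‖) ^ n *
        (C * Real.exp (s * supportFun K η) * (1 + ‖w‖) ^ (-(N + 1 + n : ℝ))) := by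
        gcongr
        · linarith
        · exact hb s η w hs
    _ = C * Real.exp (s * supportFun K η) *
        ((1 + ‖w‖) ^ (n : ℝ) * (1 + ‖w‖) ^ (-(N + 1 + n : ℝ))) := by
        rw [Real.rpow_natCast]; ring
    _ = _ := by rw [← Real.rpow_add h₀]; ring_nf

/-- A transform with the growth bound belongs to a function vanishing outside every half-space
`{x | ⟨x,η⟩ ≤ H_K(η)}`. -/
theorem GrowthBound.ae_eq_zero (hω : IsWeight ω) (h : GrowthBound ω K f)
    (hi : ∀ z, Integrable (laplaceIntegrand f z)) (η : Fin N → ℝ) :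
    ∀ᵐ x, supportFun K η < ∑ j, x j * η j → f x = 0 := by
  obtain ⟨C, hC, hb⟩ := h.exists_fourier_decay hω (r := N + 1) (by positivity)
  set B := C * ∫ w : EuclideanSpace ℝ (Fin N), (1 + ‖w‖) ^ (-(N + 1 : ℝ))
  -- Integer shifts keep the exceptional null sets countable in number; `B` does not depend on `n`.
  have hbound : ∀ n : ℕ, ∀ᵐ x, ‖f x‖ * Real.exp (n * ∑ j, x j * η j) ≤
      B * Real.exp (n * supportFun K η) := fun n => by
    have hn : (0 : ℝ) ≤ n := Nat.cast_nonneg n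
    have hF : Integrable (𝓕 (laplaceIntegrand f (imagPoint n η))) := by
      have := h.integrable_fourier hω hi hn η 0
      simp only [pow_zero, one_mul] at this
      exact (integrable_norm_iff (continuous_fourier_of_integrable
        (hi (imagPoint n η))).aestronglyMeasurable).1 this
    filter_upwards [ae_eq_fourierInv_fourier (hi (imagPoint n η)) hF] with x hx
    rw [← norm_laplaceIntegrand_imagPoint, hx]
    refine (norm_fourierInv_le_integral_norm _ x).trans ?_
    calc _ ≤ ∫ w : EuclideanSpace ℝ (Fin N),
          C * Real.exp (n * supportFun K η) * (1 + ‖w‖) ^ (-(N + 1 : ℝ)) :=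
          integral_mono hF.norm (integrable_one_add_norm_succ.const_mul _)
            fun w => hb n η w hn
      _ = _ := by rw [integral_const_mul]; ring
  filter_upwards [ae_all_iff.2 hbound] with x hx hlt
  set d := ∑ j, x j * η j - supportFun K η
  have hd : 0 < d := sub_pos.2 hlt
  have hle : ∀ n : ℕ, ‖f x‖ ≤ B * Real.exp (-(n * d)) := fun n => by
    have := hx n
    rw [← le_div_iff₀ (Real.exp_pos _), mul_div_assoc, ← Real.exp_sub] at this
    refine this.trans_eq ?_
    congr 2
    ring
  have hlim : Filter.Tendsto (fun n : ℕ => B * Real.exp (-(n * d))) Filter.atTop (nhds 0) := by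
    have := (Real.tendsto_exp_neg_atTop_nhds_zero.comp
      (tendsto_natCast_atTop_atTop.atTop_mul_const hd)).const_mul B
    simpa using this
  exact norm_le_zero_iff.1 (ge_of_tendsto' hlim hle)

theorem GrowthBound.exists_mem_beurlingTestFun (hω : IsWeight ω) (hKne : K.Nonempty)
    (hKconv : Convex ℝ K) (hKcomp : IsCompact K) (h : GrowthBound ω K f)
    (hi : ∀ z, Integrable (laplaceIntegrand f z)) :
    ∃ g, f =ᵐ[volume] g ∧ g ∈ beurlingTestFun ω K := by
  have hzero : laplaceIntegrand f (imagPoint 0 0) = f := by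
    funext t
    simp [laplaceIntegrand, imagPoint]
  have hf : Integrable f := hzero ▸ hi (imagPoint 0 0)
  have hmom : ∀ n : ℕ, Integrable fun w => ‖w‖ ^ n * ‖𝓕 f w‖ := fun n => by
    have := h.integrable_fourier hω hi le_rfl 0 n
    rwa [hzero] at this
  have hF : Integrable (𝓕 f) := by
    have := hmom 0
    simp only [pow_zero, one_mul] at this
    exact (integrable_norm_iff
      (continuous_fourier_of_integrable hf).aestronglyMeasurable).1 this
  have hae := ae_eq_fourierInv_fourier hf hF
  have hcont := continuous_fourierInv_of_integrable hF
  have hsmooth : ContDiff ℝ ((⊤ : ℕ∞) : WithTop ℕ∞) (𝓕⁻ (𝓕 f)) := by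
    have heq : 𝓕⁻ (𝓕 f) = fun v => 𝓕 (𝓕 f) (-v) :=
      funext fun v => Real.fourierInv_eq_fourier_neg _ v
    rw [heq]
    exact (Real.contDiff_fourier fun n _ => hmom n).comp contDiff_neg
  have hsupp : tsupport (𝓕⁻ (𝓕 f)) ⊆ K := by
    refine closure_minimal (fun x hx => ?_) hKcomp.isClosed
    by_contra hxK
    -- The separating functional gives an open half-space around `x` on which `f` vanishes a.e.;
    -- continuity of the inverse transform then makes it vanish at `x`.
    obtain ⟨ℓ, u, hu, hux⟩ := geometric_hahn_banach_closed_point hKconv hKcomp.isClosed hxK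
    set η : Fin N → ℝ := fun j => ℓ (EuclideanSpace.single j 1)
    have hℓ : ∀ y, ℓ y = ∑ j, y j * η j := fun y => by
      have hy := (EuclideanSpace.basisFun (Fin N) ℝ).sum_repr y
      conv_lhs => rw [← hy]
      simp [η]
    have hH : supportFun K η ≤ u := by
      refine csSup_le (hKne.image _) ?_
      rintro _ ⟨y, hy, rfl⟩
      have := hu y hy
      rw [hℓ] at this
      exact this.le
    have hU : IsOpen {y | u < ℓ y} := isOpen_lt continuous_const ℓ.continuous
    have h0 : (𝓕⁻ (𝓕 f)) =ᵐ[volume.restrict {y | u < ℓ y}] fun _ => 0 := by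
      refine (ae_restrict_iff' hU.measurableSet).2 ?_
      filter_upwards [hae, h.ae_eq_zero hω hi η] with y hy hy' hyu
      rw [← hy]
      exact hy' (hH.trans_lt (hℓ y ▸ hyu))
    exact hx (Measure.eqOn_open_of_ae_eq h0 hU hcont.continuousOn continuousOn_const hux)
  refine ⟨_, hae, mem_iInter₂.2 fun lam _ => ⟨⟨hsmooth, hsupp⟩, ?_⟩⟩
  obtain ⟨C, hC, hb⟩ := h.exists_decay hω lam (N + 1)
  refine lt_of_le_of_lt (lintegral_mono fun t => ?_)
    ((integrable_one_add_norm_succ (N := N)).const_mul C).lintegral_lt_top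
  have h₁ := hb 0 0 t le_rfl
  have h₂ : imagPoint 0 0 + toC t = toC t := by
    funext j
    simp [imagPoint]
  rw [h₂, zero_mul, Real.exp_zero, mul_one] at h₁
  rw [← fourierLaplace_congr_ae hae, ← ofReal_norm, ← ENNReal.ofReal_mul (norm_nonneg _)]
  exact ENNReal.ofReal_le_ofReal h₁

end PaleyWienerBeurling

theorem mainTheorem9 {N : ℕ} (ω : ℝ → ℝ) (hω : PaleyWienerBeurling.IsWeight ω)
    (K : Set (EuclideanSpace ℝ (Fin N))) (hKne : K.Nonempty) (hKconv : Convex ℝ K)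
    (hKcomp : IsCompact K)
    (f : EuclideanSpace ℝ (Fin N) → ℂ) (hf : Integrable f) :
    List.TFAE [
      -- `f`, as an element of `L¹`, belongs to `𝒟_(ω)(K)`
      ∃ g : EuclideanSpace ℝ (Fin N) → ℂ,
        f =ᵐ[volume] g ∧ g ∈ PaleyWienerBeurling.beurlingTestFun ω K,
      -- `f`, as an element of `L¹`, belongs to `𝒟(K)` and satisfies the derivative bounds
      ∃ g : EuclideanSpace ℝ (Fin N) → ℂ,
        f =ᵐ[volume] g ∧ g ∈ PaleyWienerBeurling.testFun K ∧
          ∀ k : ℕ, 1 ≤ k → PaleyWienerBeurling.derivSup ω k g < ∞,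
      -- `f̂` is defined on all of `ℂᴺ` and satisfies the growth bounds
      (∀ z : Fin N → ℂ, Integrable (PaleyWienerBeurling.laplaceIntegrand f z)) ∧
        ∀ k : ℕ, 1 ≤ k → ∃ C : ℝ, 0 < C ∧ ∀ z : Fin N → ℂ,
          ‖PaleyWienerBeurling.fourierLaplace f z‖ ≤
            C * Real.exp (PaleyWienerBeurling.supportFun K (fun j => (z j).im)
              - k * PaleyWienerBeurling.weightC ω z)] := by
  tfae_have 1 → 2
  -- Any `λ > 0` would do in place of `1`: only membership in `𝒟(K)` is extracted.
  | ⟨g, hfg, hg⟩ => ⟨g, hfg, (mem_iInter₂.1 hg 1 (mem_Ioi.2 one_pos)).1, fun _ hk =>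
      PaleyWienerBeurling.derivSup_lt_top hω hKcomp hg hk⟩
  tfae_have 2 → 3
  | ⟨g, hfg, hg, hd⟩ => by
    refine ⟨fun z => (PaleyWienerBeurling.integrable_laplaceIntegrand hKcomp hg z).congr
      (hfg.mono fun t ht => by simp only [PaleyWienerBeurling.laplaceIntegrand, ht]),
      fun k _ => ?_⟩
    simp only [PaleyWienerBeurling.fourierLaplace_congr_ae hfg]
    exact PaleyWienerBeurling.exists_norm_fourierLaplace_le hω hKcomp hg hd k
  tfae_have 3 → 1
  | ⟨hi, hb⟩ => PaleyWienerBeurling.GrowthBound.exists_mem_beurlingTestFun hω hKne hKconv hKcomp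
      hb hi
  tfae_finish
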